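/- Consider the Hilbert space $L^2(0,1)\otimes\mathbb{C}^2=L^2((0,1);\mathbb{C}^2)$ with norm $\|f\|^2=\int_0^1(|\phi|^2+|\gamma|^2)\,dx$ for $f=\binom{\phi}{\gamma}$. Let $D$ be the operator $Df=-f''$ with domain $$\mathrm{Dom}(D)=\{f\in W^{2,2} : \phi(0)=\phi(1)=0,\ \gamma'(0)=\gamma'(1)=0\},$$ where $W^{2,2}$ is the space of all $f\in L^2(0,1)\otimes\mathbb{C}^2$ whose generalized second derivative $f''$ lies in $L^2(0,1)\otimes\mathbb{C}^2$, and the boundary values are those of the representative of $f$ that is continuously differentiable on $[0,1]$. For a constant matrix $A\in\mathbb{C}^{2\times2}$ let $AD$ be the operator $f\mapsto A(Df)$ with domain $\mathrm{Dom}(D)$. Its spectrum $\mathrm{Spec}(AD)$ is the set of all $z\in\mathbb{C}$ for which $AD-z:\mathrm{Dom}(D)\to L^2(0,1)\otimes\mathbb{C}^2$ has no bounded inverse defined on the whole space. Then for every non-singular $A\in\mathbb{C}^{2\times 2}$, $$\mathrm{Spec}(AD)\neq\mathbb{C},$$ and for every $z\notin\mathrm{Spec}(AD)$ the resolvent $(AD-z)^{-1}$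 is a compact operator. -/

import Mathlib

open MeasureTheory Set
open scoped ContDiff

noncomputable section

/-! ### Spectrum and resolvent of an unbounded operator -/

section Unbounded

variable {H : Type*} [NormedAddCommGroup H] [NormedSpace ℂ H]

/-- The bounded operator `R` is the inverse of `K - z : Dom K → H`. -/
def IsResolventAt (K : H →ₗ.[ℂ] H) (z : ℂ) (R : H →L[ℂ] H) : Prop :=
  (∀ g : H, ∃ hg : R g ∈ K.domain, K ⟨R g, hg⟩ - z • R g = g) ∧
    ∀ f : K.domain, R (K f - z • (f : H)) = f

/-- The spectrum of an unbounded operator `K`: the complex numbers `z` for which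
`K - z : Dom K → H` has no bounded everywhere defined inverse. -/
def unboundedSpectrum (K : H →ₗ.[ℂ] H) : Set ℂ :=
  {z | ¬ ∃ R : H →L[ℂ] H, IsResolventAt K z R}

theorem exists_isResolventAt {K : H →ₗ.[ℂ] H} {z : ℂ} (hz : z ∉ unboundedSpectrum K) :
    ∃ R : H →L[ℂ] H, IsResolventAt K z R :=
  not_not.mp hz

/-- The resolvent is unique. -/
theorem IsResolventAt.eq {K : H →ₗ.[ℂ] H} {z : ℂ} {R S : H →L[ℂ] H}
    (hR : IsResolventAt K z R) (hS : IsResolventAt K z S) : R = S := by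
  ext g
  obtain ⟨hg, h⟩ := hR.1 g
  have h2 := hS.2 ⟨R g, hg⟩
  rw [h] at h2
  exact h2.symm

/-- The resolvent `(K - z)⁻¹` at a point `z` outside the spectrum. -/
def unboundedResolvent (K : H →ₗ.[ℂ] H) (z : ℂ) (hz : z ∉ unboundedSpectrum K) : H →L[ℂ] H :=
  (exists_isResolventAt hz).choose

theorem unboundedResolvent_spec (K : H →ₗ.[ℂ] H) (z : ℂ) (hz : z ∉ unboundedSpectrum K) :
    IsResolventAt K z (unboundedResolvent K z hz) :=
  (exists_isResolventAt hz).choose_spec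

end Unbounded

/-! ### The operator `D` on `L²(0,1) ⊗ ℂ²` -/

/-- `ℂ²` with its Euclidean norm. -/
abbrev C2 : Type := EuclideanSpace ℂ (Fin 2)

/-- Lebesgue measure on `(0,1)`. -/
abbrev mu01 : Measure ℝ := volume.restrict (Ioo (0 : ℝ) 1)

/-- The Hilbert space `L²(0,1) ⊗ ℂ² = L²((0,1); ℂ²)`. -/
abbrev L2C2 : Type := Lp C2 2 mu01

/-- Test functions on `(0,1)`: smooth with compact support in `(0,1)`. -/
def IsTestFun (φ : ℝ → ℝ) : Prop :=
  ContDiff ℝ ∞ φ ∧ HasCompactSupport φ ∧ tsupport φ ⊆ Ioo (0 : ℝ) 1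

/-- `h` is the generalized second derivative of `f` on `(0,1)`. -/
def IsWeakSecondDeriv (f h : L2C2) : Prop :=
  ∀ φ : ℝ → ℝ, IsTestFun φ →
    ∫ x, iteratedDeriv 2 φ x • f x ∂mu01 = ∫ x, φ x • h x ∂mu01

theorem L2C2.integrable_smul (f : L2C2) {ψ : ℝ → ℝ} (hc : Continuous ψ)
    (hs : HasCompactSupport ψ) : Integrable (fun x => ψ x • f x) mu01 := by
  obtain ⟨C, hC⟩ := hc.bounded_above_of_compact_support hs
  exact ((Lp.memLp f).integrable (by norm_num)).bdd_smul C hc.aestronglyMeasurable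
    (Filter.Eventually.of_forall hC)

theorem IsTestFun.continuous {φ : ℝ → ℝ} (h : IsTestFun φ) : Continuous φ := h.1.continuous

theorem IsTestFun.continuous_two {φ : ℝ → ℝ} (h : IsTestFun φ) :
    Continuous (iteratedDeriv 2 φ) :=
  h.1.continuous_iteratedDeriv 2 (WithTop.coe_le_coe.mpr le_top)

theorem IsTestFun.hasCompactSupport_two {φ : ℝ → ℝ} (h : IsTestFun φ) :
    HasCompactSupport (iteratedDeriv 2 φ) := by
  rw [iteratedDeriv_succ, iteratedDeriv_one]
  exact h.2.1.deriv.deriv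

theorem IsWeakSecondDeriv.add {f g h k : L2C2} (hf : IsWeakSecondDeriv f h)
    (hg : IsWeakSecondDeriv g k) : IsWeakSecondDeriv (f + g) (h + k) := by
  intro φ hφ
  have e1 : ∫ x, iteratedDeriv 2 φ x • (f + g : L2C2) x ∂mu01
      = ∫ x, (iteratedDeriv 2 φ x • f x + iteratedDeriv 2 φ x • g x) ∂mu01 := by
    refine integral_congr_ae ?_
    filter_upwards [Lp.coeFn_add f g] with x hx
    rw [hx, Pi.add_apply, smul_add]
  have e2 : ∫ x, φ x • (h + k : L2C2) x ∂mu01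
      = ∫ x, (φ x • h x + φ x • k x) ∂mu01 := by
    refine integral_congr_ae ?_
    filter_upwards [Lp.coeFn_add h k] with x hx
    rw [hx, Pi.add_apply, smul_add]
  rw [e1, e2, integral_add (f.integrable_smul hφ.continuous_two hφ.hasCompactSupport_two)
    (g.integrable_smul hφ.continuous_two hφ.hasCompactSupport_two),
    integral_add (h.integrable_smul hφ.continuous hφ.2.1)
    (k.integrable_smul hφ.continuous hφ.2.1), hf φ hφ, hg φ hφ]

theorem IsWeakSecondDeriv.smul {f h : L2C2} (c : ℂ) (hf : IsWeakSecondDeriv f h) :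
    IsWeakSecondDeriv (c • f) (c • h) := by
  intro φ hφ
  have e (ψ : ℝ → ℝ) (f : L2C2) : ∫ x, ψ x • (c • f : L2C2) x ∂mu01
      = c • ∫ x, ψ x • f x ∂mu01 := by
    rw [← integral_smul]
    refine integral_congr_ae ?_
    filter_upwards [Lp.coeFn_smul c f] with x hx
    rw [hx, Pi.smul_apply, smul_comm]
  rw [e, e, hf φ hφ]

theorem IsWeakSecondDeriv.zero : IsWeakSecondDeriv 0 0 := by
  intro φ _
  have e (ψ : ℝ → ℝ) : ∫ x, ψ x • (0 : L2C2) x ∂mu01 = 0 := by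
    refine integral_eq_zero_of_ae ?_
    filter_upwards [Lp.coeFn_zero C2 2 mu01] with x hx
    rw [hx]
    exact smul_zero _
  rw [e, e]

/-- The generalized second derivative is unique. -/
theorem IsWeakSecondDeriv.unique {f h k : L2C2} (hh : IsWeakSecondDeriv f h)
    (hk : IsWeakSecondDeriv f k) : h = k := by
  have hi (h : L2C2) : LocallyIntegrableOn h (Ioo (0 : ℝ) 1) volume :=
    IntegrableOn.locallyIntegrableOn ((Lp.memLp h).integrable (by norm_num))
  have key : ∀ᵐ x ∂(volume : Measure ℝ), x ∈ Ioo (0 : ℝ) 1 → h x - k x = 0 := by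
    refine isOpen_Ioo.ae_eq_zero_of_integral_contDiff_smul_eq_zero
      ((hi h).sub (hi k)) ?_
    intro φ h1 h2 h3
    have hφ : IsTestFun φ := ⟨h1, h2, h3⟩
    have e : ∫ x, φ x • (h x - k x) = ∫ x, φ x • (h x - k x) ∂mu01 := by
      refine (setIntegral_eq_integral_of_forall_compl_eq_zero ?_).symm
      intro x hx
      rw [image_eq_zero_of_notMem_tsupport (fun hx' => hx (h3 hx')), zero_smul]
    refine e.trans ?_
    simp_rw [smul_sub]
    rw [integral_sub (h.integrable_smul hφ.continuous h2)
      (k.integrable_smul hφ.continuous h2), ← hh φ hφ, ← hk φ hφ, sub_self]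
  apply Lp.ext
  refine (ae_restrict_iff' measurableSet_Ioo).mpr ?_
  filter_upwards [key] with x hx hx'
  exact sub_eq_zero.mp (hx hx')

/-- The Sobolev space `W^{2,2}` of all `f ∈ L²(0,1) ⊗ ℂ²` whose generalized second derivative
is in `L²(0,1) ⊗ ℂ²`. -/
def sobolev22 : Submodule ℂ L2C2 where
  carrier := {f | ∃ h, IsWeakSecondDeriv f h}
  add_mem' := fun ⟨_, hh⟩ ⟨_, hk⟩ => ⟨_, hh.add hk⟩
  zero_mem' := ⟨0, IsWeakSecondDeriv.zero⟩
  smul_mem' := fun c _ ⟨_, hh⟩ => ⟨_, hh.smul c⟩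

/-- The generalized second derivative `f ↦ f''` on `W^{2,2}`. -/
def weakSecondDeriv : sobolev22 →ₗ[ℂ] L2C2 where
  toFun f := f.2.choose
  map_add' f g := (f + g).2.choose_spec.unique (f.2.choose_spec.add g.2.choose_spec)
  map_smul' c f := (c • f).2.choose_spec.unique (f.2.choose_spec.smul c)

theorem weakSecondDeriv_spec (f : sobolev22) :
    IsWeakSecondDeriv (f : L2C2) (weakSecondDeriv f) :=
  f.2.choose_spec

/-- The boundary conditions `φ(0) = φ(1) = 0`, `γ'(0) = γ'(1) = 0` for a function
`u = (φ, γ)` on `[0,1]`. -/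
def BoundaryConditions (u : ℝ → C2) : Prop :=
  u 0 0 = 0 ∧ u 1 0 = 0 ∧
    derivWithin u (Icc (0 : ℝ) 1) 0 1 = 0 ∧ derivWithin u (Icc (0 : ℝ) 1) 1 1 = 0

/-- `Dom(D)`: the `f ∈ W^{2,2}` that satisfy the boundary conditions. The boundary values of `f`
and `f'` are those of the continuously differentiable representative of `f` on `[0,1]`. -/
def domD : Submodule ℂ L2C2 where
  carrier := {f | f ∈ sobolev22 ∧ ∃ u : ℝ → C2, ContDiffOn ℝ 1 u (Icc 0 1) ∧
    f =ᵐ[mu01] u ∧ BoundaryConditions u}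
  add_mem' := by
    rintro f g ⟨hf, u, hu, hfu, b1, b2, b3, b4⟩ ⟨hg, v, hv, hgv, c1, c2, c3, c4⟩
    have d {w : ℝ → C2} (hw : ContDiffOn ℝ 1 w (Icc 0 1)) :
        DifferentiableOn ℝ w (Icc 0 1) := hw.differentiableOn (by norm_num)
    refine ⟨add_mem hf hg, u + v, hu.add hv, (Lp.coeFn_add f g).trans (hfu.add hgv), ?_⟩
    refine ⟨by simp [b1, c1], by simp [b2, c2], ?_, ?_⟩
    · rw [derivWithin_add (d hu 0 (by simp)) (d hv 0 (by simp))]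
      simp [b3, c3]
    · rw [derivWithin_add (d hu 1 (by simp)) (d hv 1 (by simp))]
      simp [b4, c4]
  zero_mem' := by
    refine ⟨zero_mem _, 0, contDiffOn_const, Lp.coeFn_zero _ _ _, by simp, by simp, ?_, ?_⟩ <;>
      simp
  smul_mem' := by
    rintro c f ⟨hf, u, hu, hfu, b1, b2, b3, b4⟩
    have d : DifferentiableOn ℝ u (Icc 0 1) := hu.differentiableOn (by norm_num)
    refine ⟨sobolev22.smul_mem c hf, c • u, hu.const_smul c,
      (Lp.coeFn_smul c f).trans (hfu.const_smul c), ?_⟩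
    refine ⟨by simp [b1], by simp [b2], ?_, ?_⟩
    · rw [derivWithin_const_smul c (d 0 (by simp))]
      simp [b3]
    · rw [derivWithin_const_smul c (d 1 (by simp))]
      simp [b4]

theorem domD_le_sobolev22 : domD ≤ sobolev22 := fun _ hf => hf.1

/-- The operator `D f = -f''` with domain `Dom(D)`. -/
def opD : L2C2 →ₗ.[ℂ] L2C2 where
  domain := domD
  toFun := -(weakSecondDeriv ∘ₗ Submodule.inclusion domD_le_sobolev22)

/-- Pointwise multiplication by a constant matrix `A` on `L²(0,1) ⊗ ℂ²`. -/
def mulA (A : Matrix (Fin 2) (Fin 2) ℂ) : L2C2 →L[ℂ] L2C2 :=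
  (Matrix.toEuclideanCLM (n := Fin 2) (𝕜 := ℂ) A).compLpL 2 mu01

/-- The operator `AD`, `f ↦ A (D f)`, with domain `Dom(D)`. -/
def opAD (A : Matrix (Fin 2) (Fin 2) ℂ) : L2C2 →ₗ.[ℂ] L2C2 :=
  (mulA A : L2C2 →ₗ[ℂ] L2C2).compPMap opD

end

noncomputable section

/-! `D` is Dirichlet in the first coordinate and Neumann in the second; its kernel is spanned by the
constant `e = basisConst 1`. Let `P` be `kerProj` and `G` be `green`, the compact inverse of `D +
P`. With `M = A⁻¹`, the equation `(AD - z) f = g` becomes `f - K f = G M g`, where `K = G (P + z M)`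
is the compact operator `pencil A z` (`sub_pencil_eq`, `opAD_sub_smul_eq`). If `1 - K` is injective,
the Fredholm alternative inverts it and gives a resolvent. Any resolvent satisfies `R = K R + G M`,
hence is compact.

It remains to find `z` with `1 - K` injective (`exists_pencil_injective`); `z = 0` fails because `K
e = e` there. If `K f = f` with `z ≠ 0`, then `f = c e + z G M f`, and the second coordinate of `M
f` has mean zero. A bounded functional `L` with `L f = 0` for all such `f` and `L e ≠ 0` then forces
`f = 0` for small `z`. The mean of the second coordinate of `M f` serves if `M 1 1 ≠ 0`; otherwise
that of `M G M f` serves, and non-singularity gives `L e ≠ 0`.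

Compactness of `G` comes from the Volterra operator. Du Bois-Reymond's lemma puts each element of
the domain in the form of an iterated primitive plus an affine function, so that boundary conditions
become algebraic. -/

instance isProbabilityMeasure_mu01 : IsProbabilityMeasure mu01 :=
  ⟨by rw [Measure.restrict_apply_univ, Real.volume_Ioo]; simp⟩

/-! ### The Volterra operator and its compactness. -/

namespace L2C2

theorem integrable (g : L2C2) : Integrable g mu01 := (Lp.memLp g).integrable (by norm_num)

/-- Hölder's inequality against the indicator of `s`. The square root makes primitives 1/2-Hölder,
uniformly on bounded sets of `g`. -/
theorem norm_setIntegral_le (g : L2C2) (s : Set ℝ) :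
    ‖∫ t in s, g t ∂mu01‖ ≤ ‖g‖ * √(mu01.real s) := by
  have h1 : ‖∫ t in s, g t ∂mu01‖ₑ ≤ eLpNorm g 1 (mu01.restrict s) := by
    rw [eLpNorm_one_eq_lintegral_enorm]
    exact enorm_integral_le_lintegral_enorm _
  have h2 : eLpNorm g 1 (mu01.restrict s)
      ≤ eLpNorm g 2 (mu01.restrict s) * mu01 s ^ (2⁻¹ : ℝ) := by
    have := eLpNorm_le_eLpNorm_mul_rpow_measure_univ (μ := mu01.restrict s)
      (p := 1) (q := 2) (by norm_num) (Lp.aestronglyMeasurable g).restrict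
    rw [Measure.restrict_apply_univ] at this
    convert this using 3
    norm_num
  have h3 : eLpNorm g 2 (mu01.restrict s) ≤ eLpNorm g 2 mu01 :=
    eLpNorm_mono_measure _ Measure.restrict_le_self
  have h4 := h1.trans (h2.trans (mul_le_mul_left h3 _))
  have h5 := ENNReal.toReal_mono (ENNReal.mul_ne_top (Lp.eLpNorm_ne_top g)
    (ENNReal.rpow_ne_top_of_nonneg (by norm_num) (measure_ne_top _ _))) h4
  rw [ENNReal.toReal_mul, ← ENNReal.toReal_rpow] at h5
  simpa [Lp.norm_def, Real.sqrt_eq_rpow, Measure.real] using h5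

/-- The primitive of `g` that vanishes at `0`. -/
def prim (g : L2C2) (x : ℝ) : C2 := ∫ t in Iic x, g t ∂mu01

theorem norm_prim_le (g : L2C2) (x : ℝ) : ‖g.prim x‖ ≤ ‖g‖ := by
  refine (g.norm_setIntegral_le _).trans (mul_le_of_le_one_right (norm_nonneg _) ?_)
  exact Real.sqrt_le_one.mpr measureReal_le_one

theorem norm_prim_sub_prim_le (g : L2C2) {x y : ℝ} (h : x ≤ y) :
    ‖g.prim y - g.prim x‖ ≤ ‖g‖ * √(y - x) := by
  have e : g.prim y - g.prim x = ∫ t in Ioc x y, g t ∂mu01 := by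
    rw [prim, prim, ← Iic_union_Ioc_eq_Iic h,
      setIntegral_union (Iic_disjoint_Ioc le_rfl) measurableSet_Ioc
        g.integrable.integrableOn g.integrable.integrableOn, add_sub_cancel_left]
  rw [e]
  refine (g.norm_setIntegral_le _).trans ?_
  gcongr
  have : mu01 (Ioc x y) ≤ volume (Ioc x y) := Measure.restrict_le_self _
  rw [Real.volume_Ioc] at this
  exact ENNReal.toReal_le_of_le_ofReal (by linarith) this

theorem continuous_prim (g : L2C2) : Continuous g.prim := by
  have h (x y : ℝ) : ‖g.prim y - g.prim x‖ ≤ ‖g‖ * √|y - x| := by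
    rcases le_total x y with h | h
    · rw [abs_of_nonneg (by linarith)]
      exact g.norm_prim_sub_prim_le h
    · rw [norm_sub_rev, abs_sub_comm, abs_of_nonneg (by linarith)]
      exact g.norm_prim_sub_prim_le h
  refine continuous_iff_continuousAt.2 fun x => tendsto_iff_norm_sub_tendsto_zero.2 ?_
  refine squeeze_zero (fun y => norm_nonneg _) (fun y => h x y) ?_
  have : Continuous fun y => ‖g‖ * √|y - x| := by fun_prop
  simpa using this.tendsto x

theorem prim_add (f g : L2C2) (x : ℝ) : (f + g).prim x = f.prim x + g.prim x := by
  rw [prim, prim, prim, ← integral_add f.integrable.integrableOn g.integrable.integrableOn]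
  exact integral_congr_ae (ae_restrict_of_ae (Lp.coeFn_add f g))

theorem prim_smul (c : ℂ) (f : L2C2) (x : ℝ) : (c • f).prim x = c • f.prim x := by
  rw [prim, prim, ← integral_smul]
  exact integral_congr_ae (ae_restrict_of_ae (Lp.coeFn_smul c f))

/-- The value of the primitive at `x`, as a functional. -/
def primL (x : ℝ) : L2C2 →L[ℂ] C2 :=
  LinearMap.mkContinuous
    { toFun := fun g => g.prim x
      map_add' := fun f g => prim_add f g x
      map_smul' := fun c f => prim_smul c f x } 1
    fun g => by simpa using g.norm_prim_le x

@[simp] theorem primL_apply (x : ℝ) (g : L2C2) : primL x g = g.prim x := rfl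

theorem memLp_prim (g : L2C2) : MemLp g.prim 2 mu01 :=
  MemLp.of_bound g.continuous_prim.aestronglyMeasurable ‖g‖
    (Filter.Eventually.of_forall g.norm_prim_le)

theorem norm_le_of_ae_bound {f : L2C2} {C : ℝ} (hC : 0 ≤ C) (h : ∀ᵐ x ∂mu01, ‖f x‖ ≤ C) :
    ‖f‖ ≤ C := by
  have := Lp.norm_le_of_ae_bound hC h
  simpa [measureUnivNNReal] using this

/-- The Volterra operator, `g ↦ ∫₀ˣ g`. -/
def volterra : L2C2 →L[ℂ] L2C2 :=
  LinearMap.mkContinuous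
    { toFun := fun g => g.memLp_prim.toLp
      map_add' := fun f g => by
        rw [← MemLp.toLp_add]
        exact MemLp.toLp_congr _ _ (Filter.Eventually.of_forall fun x => prim_add f g x)
      map_smul' := fun c f => by
        rw [RingHom.id_apply, ← MemLp.toLp_const_smul]
        exact MemLp.toLp_congr _ _ (Filter.Eventually.of_forall fun x => prim_smul c f x) } 1
    fun g => by
      rw [one_mul]
      refine norm_le_of_ae_bound (norm_nonneg _) ?_
      filter_upwards [g.memLp_prim.coeFn_toLp] with x hx
      exact (congrArg norm hx).trans_le (g.norm_prim_le x)

theorem volterra_ae (g : L2C2) : volterra g =ᵐ[mu01] g.prim := g.memLp_prim.coeFn_toLp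

/-- The operator `c ↦ w • c` from `ℂ²` to `L²`, for a scalar function `w`. -/
def profile (w : ℝ → ℝ) (hw : MemLp w 2 mu01) : C2 →L[ℂ] L2C2 :=
  LinearMap.toContinuousLinearMap
    { toFun := fun c => ((ContinuousLinearMap.toSpanSingleton ℝ c).comp_memLp' hw).toLp
      map_add' := fun c d => by
        rw [← MemLp.toLp_add]
        exact MemLp.toLp_congr _ _ (Filter.Eventually.of_forall fun x => by simp)
      map_smul' := fun c f => by
        rw [RingHom.id_apply, ← MemLp.toLp_const_smul]
        refine MemLp.toLp_congr _ _ (Filter.Eventually.of_forall fun x => ?_)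
        simp [smul_comm (w x) c f] }

theorem profile_ae (w : ℝ → ℝ) (hw : MemLp w 2 mu01) (c : C2) :
    profile w hw c =ᵐ[mu01] fun x => w x • c :=
  MemLp.coeFn_toLp ((ContinuousLinearMap.toSpanSingleton ℝ c).comp_memLp' hw)

theorem memLp_floor_eq (n k : ℕ) :
    MemLp (fun x : ℝ => if ⌊n * x⌋₊ = k then (1 : ℝ) else 0) 2 mu01 := by
  refine MemLp.of_bound (C := 1) ?_ (Filter.Eventually.of_forall fun x => ?_)
  · have h1 : Measurable fun m : ℕ => if m = k then (1 : ℝ) else 0 := measurable_from_top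
    have h2 : Measurable fun x : ℝ => ⌊n * x⌋₊ :=
      Nat.measurable_floor.comp (measurable_const.mul measurable_id)
    exact (h1.comp h2).aestronglyMeasurable
  · split_ifs <;> simp

/-- The approximation of the Volterra operator that freezes the primitive on each of `n`
intervals. -/
def volterraStep (n : ℕ) : L2C2 →L[ℂ] L2C2 :=
  ∑ k ∈ Finset.range n, (profile _ (memLp_floor_eq n k)).comp (primL (k / n))

theorem volterraStep_ae {n : ℕ} (hn : 0 < n) (g : L2C2) :
    ∀ᵐ x ∂mu01, volterraStep n g x = g.prim (⌊n * x⌋₊ / n) := by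
  have h1 : ∀ᵐ x ∂mu01, ∀ k : ℕ, profile _ (memLp_floor_eq n k) (g.prim (k / n)) x
      = (if ⌊n * x⌋₊ = k then (1 : ℝ) else 0) • g.prim (k / n) :=
    ae_all_iff.2 fun k => profile_ae _ _ _
  have h2 : volterraStep n g
      = ∑ k ∈ Finset.range n, profile _ (memLp_floor_eq n k) (g.prim (k / n)) := by
    simp [volterraStep]
  rw [h2]
  filter_upwards [h1, ae_restrict_mem measurableSet_Ioo,
    Lp.coeFn_finsetSum (Finset.range n)
      (fun k => profile _ (memLp_floor_eq n k) (g.prim (k / n)))] with x hx hx' hs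
  rw [hs, Finset.sum_apply, Finset.sum_congr rfl fun k _ => hx k]
  -- Since `x < 1`, the index of the interval containing `x` lies in the range of summation, so
  -- exactly one term survives.
  have hlt : ⌊n * x⌋₊ < n := by
    have hn' : (0 : ℝ) < n := by exact_mod_cast hn
    rw [Nat.floor_lt (by have := hx'.1; positivity)]
    nlinarith [hx'.2]
  simp [hlt]

/-- Each summand factors through the finite-dimensional space `C2`. -/
theorem isCompactOperator_volterraStep (n : ℕ) : IsCompactOperator (volterraStep n) := by
  unfold volterraStep
  induction Finset.range n using Finset.induction_on with
  | empty =>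
    rw [Finset.sum_empty]
    exact isCompactOperator_zero (M₁ := L2C2) (M₂ := L2C2)
  | insert k s hk ih =>
    rw [Finset.sum_insert hk]
    have h : IsCompactOperator (primL (k / n)) := isCompactOperator_of_locallyCompactSpace_dom _
    exact (h.clm_comp (profile _ (memLp_floor_eq n k))).add ih

theorem norm_volterra_sub_step_le {n : ℕ} (hn : 0 < n) :
    ‖volterra - volterraStep n‖ ≤ √(1 / n) := by
  refine ContinuousLinearMap.opNorm_le_bound _ (by positivity) fun g => ?_
  refine norm_le_of_ae_bound (by positivity) ?_
  have hn' : (0 : ℝ) < n := by exact_mod_cast hn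
  filter_upwards [volterra_ae g, volterraStep_ae hn g, Lp.coeFn_sub (volterra g)
    (volterraStep n g), ae_restrict_mem measurableSet_Ioo] with x h1 h2 h3 hx
  rw [sub_apply, h3, Pi.sub_apply, h1, h2]
  have hx0 : 0 ≤ n * x := by have := hx.1; positivity
  have h4 : (⌊n * x⌋₊ : ℝ) / n ≤ x := by
    rw [div_le_iff₀ hn', mul_comm x]
    exact Nat.floor_le hx0
  refine (g.norm_prim_sub_prim_le h4).trans ?_
  rw [mul_comm]
  gcongr
  rw [sub_le_iff_le_add, ← add_div, le_div_iff₀ hn']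
  linarith [Nat.lt_floor_add_one (n * x)]

/-- A norm limit of finite-rank operators; the Hölder bound gives the rate `√(1 / n)`. -/
theorem isCompactOperator_volterra : IsCompactOperator volterra := by
  refine isCompactOperator_of_tendsto (F := volterraStep) (l := Filter.atTop) ?_
    (Filter.Eventually.of_forall isCompactOperator_volterraStep)
  rw [tendsto_iff_norm_sub_tendsto_zero]
  have h1 : Filter.Tendsto (fun n : ℕ => √(1 / (n : ℝ))) Filter.atTop (nhds 0) := by
    have := (Real.continuous_sqrt.tendsto 0).comp tendsto_one_div_atTop_nhds_zero_nat
    simpa [Function.comp_def] using this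
  refine squeeze_zero' (Filter.Eventually.of_forall fun _ => norm_nonneg _) ?_ h1
  filter_upwards [Filter.eventually_gt_atTop 0] with n hn
  rw [norm_sub_rev]
  exact norm_volterra_sub_step_le hn

end L2C2

/-! ### Test functions -/

namespace IsTestFun

theorem deriv {φ : ℝ → ℝ} (h : IsTestFun φ) : IsTestFun (deriv φ) := by
  refine ⟨?_, h.2.1.deriv, tsupport_deriv_subset.trans h.2.2⟩
  have := h.1
  rw [contDiff_infty_iff_deriv] at this
  exact this.2

theorem differentiable {φ : ℝ → ℝ} (h : IsTestFun φ) : Differentiable ℝ φ :=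
  h.1.differentiable (by simp)

theorem iteratedDeriv_two (φ : ℝ → ℝ) : iteratedDeriv 2 φ = _root_.deriv (_root_.deriv φ) := by
  rw [iteratedDeriv_succ, iteratedDeriv_one]

theorem eq_zero_of_notMem {φ : ℝ → ℝ} (h : IsTestFun φ) {x : ℝ} (hx : x ∉ Ioo (0 : ℝ) 1) :
    φ x = 0 :=
  image_eq_zero_of_notMem_tsupport fun hx' => hx (h.2.2 hx')

theorem sub_smul {φ ψ : ℝ → ℝ} (hφ : IsTestFun φ) (hψ : IsTestFun ψ) (c : ℝ) :
    IsTestFun fun x => φ x - c * ψ x := by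
  have h2 : HasCompactSupport fun x => φ x - c * ψ x :=
    hφ.2.1.sub (hψ.2.1.mul_left (f := fun _ => c))
  refine ⟨hφ.1.sub (contDiff_const.mul hψ.1), h2, ?_⟩
  have hsub : tsupport (fun x => φ x - c * ψ x) ⊆ tsupport φ ∪ tsupport ψ := by
    refine closure_minimal (fun x hx => ?_) ((isClosed_tsupport _).union (isClosed_tsupport _))
    by_contra hx'
    rw [mem_union, not_or] at hx'
    exact hx (by simp [image_eq_zero_of_notMem_tsupport hx'.1,
      image_eq_zero_of_notMem_tsupport hx'.2])
  exact hsub.trans (union_subset hφ.2.2 hψ.2.2)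

theorem setIntegral_mu01_Ici_deriv {φ : ℝ → ℝ} (h : IsTestFun φ) (t : ℝ) :
    ∫ x in Ici t, _root_.deriv φ x ∂mu01 = -φ t := by
  have e : ∫ x in Ici t, _root_.deriv φ x ∂mu01 = ∫ x in Ioi t, _root_.deriv φ x := by
    rw [Measure.restrict_restrict measurableSet_Ici, ← integral_Ici_eq_integral_Ioi]
    refine (setIntegral_eq_of_subset_of_forall_sdiff_eq_zero
      measurableSet_Ici inter_subset_left fun x hx => ?_).symm
    exact h.deriv.eq_zero_of_notMem fun hx' => hx.2 ⟨hx.1, hx'⟩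
  rw [e, h.2.1.integral_Ioi_deriv_eq (h.1.of_le (by simp))]

/-- A test function of mean zero is the derivative of a test function. -/
theorem exists_deriv_eq {ψ : ℝ → ℝ} (h : IsTestFun ψ) (h0 : ∫ x, ψ x = 0) :
    ∃ φ, IsTestFun φ ∧ _root_.deriv φ = ψ := by
  have hi : Integrable ψ := h.continuous.integrable_of_hasCompactSupport h.2.1
  have hd (x : ℝ) : HasDerivAt (fun x => ∫ t in (0 : ℝ)..x, ψ t) (ψ x) x :=
    intervalIntegral.integral_hasDerivAt_right hi.intervalIntegrable
      (h.continuous.stronglyMeasurableAtFilter _ _) h.continuous.continuousAt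
  have hderiv : _root_.deriv (fun x => ∫ t in (0 : ℝ)..x, ψ t) = ψ :=
    funext fun x => (hd x).deriv
  -- The primitive vanishes left of `α` trivially and right of `β` because `ψ` has mean zero, so its
  -- support stays inside `(0,1)`.
  obtain ⟨α, β, hα, hβ, hsub⟩ : ∃ α β : ℝ, 0 < α ∧ β < 1 ∧ tsupport ψ ⊆ Icc α β := by
    rcases (tsupport ψ).eq_empty_or_nonempty with he | hne
    · exact ⟨1 / 2, 1 / 2, by norm_num, by norm_num, by simp [he]⟩
    · have hK : IsCompact (tsupport ψ) := h.2.1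
      exact ⟨sInf (tsupport ψ), sSup (tsupport ψ), (h.2.2 (hK.sInf_mem hne)).1,
        (h.2.2 (hK.sSup_mem hne)).2,
        fun x hx => ⟨csInf_le hK.bddBelow hx, le_csSup hK.bddAbove hx⟩⟩
  have hz {x : ℝ} (hx : x ∉ Icc α β) : ψ x = 0 :=
    image_eq_zero_of_notMem_tsupport fun hx' => hx (hsub hx')
  have hint (x : ℝ) : ∫ t in (0 : ℝ)..x, ψ t = ∫ t in Iic x, ψ t := by
    rw [← intervalIntegral.integral_Iic_sub_Iic hi.integrableOn hi.integrableOn, sub_eq_self]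
    refine setIntegral_eq_zero_of_forall_eq_zero fun t ht => hz fun ht' => ?_
    exact absurd (ht'.1.trans ht) (not_le.2 hα)
  have hsupp : tsupport (fun x => ∫ t in (0 : ℝ)..x, ψ t) ⊆ Icc α β := by
    refine closure_minimal (fun x hx => ?_) isClosed_Icc
    by_contra hx'
    refine hx ?_
    refine (hint x).trans ?_
    rw [mem_Icc, not_and_or, not_le, not_le] at hx'
    rcases hx' with hx' | hx'
    · exact setIntegral_eq_zero_of_forall_eq_zero fun t ht => hz fun ht' =>
        absurd (ht'.1.trans ht) (not_le.2 hx')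
    · rw [← h0]
      refine setIntegral_eq_integral_of_forall_compl_eq_zero fun t ht => hz fun ht' => ?_
      exact ht (ht'.2.trans hx'.le)
  refine ⟨_, ⟨?_, ?_, ?_⟩, hderiv⟩
  · rw [contDiff_infty_iff_deriv, hderiv]
    exact ⟨fun x => (hd x).differentiableAt, h.1⟩
  · exact isCompact_Icc.of_isClosed_subset (isClosed_tsupport _) hsupp
  · exact hsupp.trans fun x hx => ⟨hα.trans_le hx.1, hx.2.trans_lt hβ⟩

theorem exists_integral_eq_one : ∃ η, IsTestFun η ∧ ∫ x, η x = 1 := by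
  let b : ContDiffBump (1 / 2 : ℝ) := ⟨1 / 8, 1 / 4, by norm_num, by norm_num⟩
  refine ⟨b.normed volume, ⟨b.contDiff_normed, b.hasCompactSupport_normed, ?_⟩,
    b.integral_normed⟩
  rw [b.tsupport_normed_eq, Real.closedBall_eq_Icc]
  intro x hx
  have h1 : (1 / 2 : ℝ) - 1 / 4 ≤ x := hx.1
  have h2 : x ≤ (1 / 2 : ℝ) + 1 / 4 := hx.2
  constructor <;> linarith

theorem integral_mu01 {φ : ℝ → ℝ} (h : IsTestFun φ) : ∫ x, φ x ∂mu01 = ∫ x, φ x :=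
  setIntegral_eq_integral_of_forall_compl_eq_zero fun _ hx => h.eq_zero_of_notMem hx

/-- A test function is the derivative of a test function up to a multiple of `η`. -/
theorem exists_deriv_eq_sub {ψ η : ℝ → ℝ} (h : IsTestFun ψ) (hη : IsTestFun η)
    (h1 : ∫ x, η x = 1) :
    ∃ φ, IsTestFun φ ∧ _root_.deriv φ = fun x => ψ x - (∫ x, ψ x) * η x := by
  refine (h.sub_smul hη _).exists_deriv_eq ?_
  rw [integral_sub (h.continuous.integrable_of_hasCompactSupport h.2.1)
    ((hη.continuous.integrable_of_hasCompactSupport hη.2.1).const_mul _),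
    integral_const_mul, h1, mul_one, sub_self]

end IsTestFun

/-! ### Weak derivatives -/

namespace L2C2

/-- The pairing of a test function with an element of `L²`. -/
def pair (ψ : ℝ → ℝ) (f : L2C2) : C2 := ∫ x, ψ x • f x ∂mu01

theorem pair_sub {ψ : ℝ → ℝ} (h : IsTestFun ψ) (f g : L2C2) :
    pair ψ (f - g) = pair ψ f - pair ψ g := by
  rw [pair, pair, pair, ← integral_sub (f.integrable_smul h.continuous h.2.1)
    (g.integrable_smul h.continuous h.2.1)]
  refine integral_congr_ae ?_
  filter_upwards [Lp.coeFn_sub f g] with x hx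
  rw [hx, Pi.sub_apply, smul_sub]

theorem pair_sub_smul {φ ψ : ℝ → ℝ} (hφ : IsTestFun φ) (hψ : IsTestFun ψ) (c : ℝ) (f : L2C2) :
    pair (fun x => φ x - c * ψ x) f = pair φ f - c • pair ψ f := by
  rw [pair, pair, pair, ← integral_smul, ← integral_sub
    (f.integrable_smul hφ.continuous hφ.2.1)
    (by exact (f.integrable_smul hψ.continuous hψ.2.1).smul c)]
  refine integral_congr_ae (Filter.Eventually.of_forall fun x => ?_)
  simp [sub_smul, mul_smul]

/-- The constant function `c`. -/
def const : C2 →L[ℂ] L2C2 := Lp.constL 2 mu01 ℂ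

theorem const_ae (c : C2) : const c =ᵐ[mu01] fun _ => c := Lp.coeFn_const 2 mu01 c

theorem pair_const {ψ : ℝ → ℝ} (h : IsTestFun ψ) (c : C2) :
    pair ψ (const c) = (∫ x, ψ x) • c := by
  rw [pair, ← h.integral_mu01, ← integral_smul_const]
  refine integral_congr_ae ?_
  filter_upwards [const_ae c] with x hx
  rw [hx]

/-- Such an `f` is a weak second derivative of `0`, so uniqueness applies. -/
theorem eq_zero_of_pair_eq_zero {f : L2C2} (h : ∀ ψ, IsTestFun ψ → pair ψ f = 0) : f = 0 := by
  refine IsWeakSecondDeriv.unique (f := 0) (fun φ hφ => ?_) IsWeakSecondDeriv.zero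
  rw [IsWeakSecondDeriv.zero φ hφ]
  refine Eq.trans ?_ (h φ hφ).symm
  refine integral_eq_zero_of_ae ?_
  filter_upwards [Lp.coeFn_zero C2 2 mu01] with x hx
  rw [hx]
  exact smul_zero _

/-- Integration by parts. -/
theorem pair_deriv_volterra {φ : ℝ → ℝ} (h : IsTestFun φ) (g : L2C2) :
    pair (deriv φ) (volterra g) = -pair φ g := by
  have hF : Integrable (Function.uncurry fun x t : ℝ =>
      (if t ≤ x then deriv φ x else 0) • g t) (mu01.prod mu01) := by
    obtain ⟨C, hC⟩ := h.deriv.continuous.bounded_above_of_compact_support h.deriv.2.1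
    have hm : AEStronglyMeasurable (fun p : ℝ × ℝ => if p.2 ≤ p.1 then deriv φ p.1 else 0)
        (mu01.prod mu01) :=
      (Measurable.ite (measurableSet_le measurable_snd measurable_fst)
        (h.deriv.continuous.measurable.comp measurable_fst)
        measurable_const).aestronglyMeasurable
    refine (g.integrable.comp_snd mu01).bdd_smul C
      hm
      (Filter.Eventually.of_forall fun p => ?_)
    split_ifs
    · exact hC _
    · simpa using (norm_nonneg _).trans (hC 0)
  calc pair (deriv φ) (volterra g)
      = ∫ x, ∫ t, (if t ≤ x then deriv φ x else 0) • g t ∂mu01 ∂mu01 := by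
        refine integral_congr_ae ?_
        filter_upwards [volterra_ae g] with x hx
        rw [hx, prim, ← integral_smul, ← integral_indicator measurableSet_Iic]
        refine integral_congr_ae (Filter.Eventually.of_forall fun t => ?_)
        by_cases ht : t ≤ x <;> simp [ht, indicator]
    -- Fubini on the triangle `t ≤ x`; the inner integral of `deriv φ` over `x ≥ t` is then `-φ t`.
    _ = ∫ t, ∫ x, (if t ≤ x then deriv φ x else 0) • g t ∂mu01 ∂mu01 :=
        integral_integral_swap hF
    _ = ∫ t, -(φ t • g t) ∂mu01 := by
        refine integral_congr_ae (Filter.Eventually.of_forall fun t => ?_)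
        dsimp only
        rw [integral_smul_const, ← neg_smul, ← h.setIntegral_mu01_Ici_deriv,
          ← integral_indicator measurableSet_Ici]
        simp only [indicator, mem_Ici]
    _ = -pair φ g := integral_neg _

theorem isWeakSecondDeriv_iff {f h : L2C2} :
    IsWeakSecondDeriv f h ↔ ∀ φ, IsTestFun φ → pair (deriv (deriv φ)) f = pair φ h := by
  simp only [IsWeakSecondDeriv, IsTestFun.iteratedDeriv_two, pair]

theorem isWeakSecondDeriv_volterra_volterra (g : L2C2) :
    IsWeakSecondDeriv (volterra (volterra g)) g := by
  rw [isWeakSecondDeriv_iff]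
  intro φ hφ
  rw [pair_deriv_volterra hφ.deriv, pair_deriv_volterra hφ, neg_neg]

theorem pair_deriv_const {φ : ℝ → ℝ} (h : IsTestFun φ) (c : C2) :
    pair (deriv φ) (const c) = 0 := by
  rw [pair_const h.deriv, integral_eq_zero_of_hasDerivAt_of_integrable
    (fun x => (h.differentiable x).hasDerivAt)
    (h.deriv.continuous.integrable_of_hasCompactSupport h.deriv.2.1)
    (h.continuous.integrable_of_hasCompactSupport h.2.1), zero_smul]

theorem isWeakSecondDeriv_const (c : C2) : IsWeakSecondDeriv (const c) 0 := by
  rw [isWeakSecondDeriv_iff]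
  intro φ hφ
  rw [pair_deriv_const hφ.deriv, ← map_zero const, pair_const hφ, smul_zero]

theorem isWeakSecondDeriv_volterra_const (c : C2) :
    IsWeakSecondDeriv (volterra (const c)) 0 := by
  rw [isWeakSecondDeriv_iff]
  intro φ hφ
  rw [pair_deriv_volterra hφ.deriv, pair_deriv_const hφ, neg_zero, ← map_zero const,
    pair_const hφ, smul_zero]

/-- The lemma of du Bois-Reymond. -/
theorem exists_eq_const {f : L2C2} (h : ∀ φ, IsTestFun φ → pair (deriv φ) f = 0) :
    ∃ c, f = const c := by
  obtain ⟨η, hη, h1⟩ := IsTestFun.exists_integral_eq_one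
  -- Testing the would-be constant against `η`, which has integral one, identifies it as `pair η f`.
  refine ⟨pair η f, sub_eq_zero.1 (eq_zero_of_pair_eq_zero fun ψ hψ => ?_)⟩
  obtain ⟨φ, hφ, hd⟩ := hψ.exists_deriv_eq_sub hη h1
  have := h φ hφ
  rw [hd, pair_sub_smul hψ hη] at this
  rw [pair_sub hψ, pair_const hψ, this]

/-- An element of `L²` with vanishing weak second derivative is affine. -/
theorem exists_eq_const_add_volterra_const {f : L2C2} (h : IsWeakSecondDeriv f 0) :
    ∃ a b, f = const a + volterra (const b) := by
  rw [isWeakSecondDeriv_iff] at h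
  obtain ⟨η, hη, h1⟩ := IsTestFun.exists_integral_eq_one
  -- The slope is the weak derivative of `f` tested against `η`, that is `-pair (deriv η) f`.
  obtain ⟨a, ha⟩ := exists_eq_const (f := f - volterra (const (-pair (deriv η) f)))
    fun ψ hψ => by
      obtain ⟨φ, hφ, hd⟩ := hψ.exists_deriv_eq_sub hη h1
      have h2 := h φ hφ
      have h3 : deriv (deriv φ) = fun x => deriv ψ x - (∫ x, ψ x) * deriv η x := by
        rw [hd]
        funext x
        rw [deriv_fun_sub (hψ.differentiable x) ((hη.differentiable x).const_mul _),
          deriv_const_mul _ (hη.differentiable x)]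
      rw [h3, pair_sub_smul hψ.deriv hη.deriv, ← map_zero const, pair_const hφ, smul_zero] at h2
      rw [pair_sub hψ.deriv, pair_deriv_volterra hψ, pair_const hψ, smul_neg, neg_neg, h2]
  exact ⟨a, _, sub_eq_iff_eq_add.1 ha⟩

/-! ### Primitives on the unit interval -/

theorem prim_zero_right (g : L2C2) : g.prim 0 = 0 := by
  have h : mu01 (Iic 0) = 0 := by
    rw [Measure.restrict_apply measurableSet_Iic]
    have : Iic (0 : ℝ) ∩ Ioo 0 1 = ∅ := by
      ext x
      simp only [mem_inter_iff, mem_Iic, mem_Ioo, mem_empty_iff_false, iff_false]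
      rintro ⟨h1, h2, _⟩
      linarith
    rw [this, measure_empty]
  rw [prim, Measure.restrict_eq_zero.2 h, integral_zero_measure]

theorem restrict_Iic_mu01 {x : ℝ} (hx : x ∈ Icc (0 : ℝ) 1) :
    mu01.restrict (Iic x) = volume.restrict (Ioc 0 x) := by
  rw [mu01, restrict_Ioo_eq_restrict_Ioc, Measure.restrict_restrict measurableSet_Iic]
  congr 1
  ext t
  simp only [mem_inter_iff, mem_Iic, mem_Ioc]
  exact ⟨fun h => ⟨h.2.1, h.1⟩, fun h => ⟨h.2, h.1, h.2.trans hx.2⟩⟩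

theorem prim_const (c : C2) {x : ℝ} (hx : x ∈ Icc (0 : ℝ) 1) : (const c).prim x = x • c := by
  rw [prim, integral_congr_ae (ae_restrict_of_ae (const_ae c)), restrict_Iic_mu01 hx,
    setIntegral_const]
  simp [hx.1]

/-- The iterated primitive of `h`. -/
def primTwo (h : L2C2) (x : ℝ) : C2 := ∫ t in (0 : ℝ)..x, h.prim t

theorem prim_volterra (h : L2C2) {x : ℝ} (hx : x ∈ Icc (0 : ℝ) 1) :
    (volterra h).prim x = h.primTwo x := by
  rw [prim, integral_congr_ae (ae_restrict_of_ae (volterra_ae h)), restrict_Iic_mu01 hx,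
    primTwo, intervalIntegral.integral_of_le hx.1]

theorem hasDerivAt_primTwo (h : L2C2) (x : ℝ) : HasDerivAt h.primTwo (h.prim x) x :=
  intervalIntegral.integral_hasDerivAt_right (h.continuous_prim.intervalIntegrable _ _)
    (h.continuous_prim.stronglyMeasurableAtFilter _ _) h.continuous_prim.continuousAt

/-- The continuously differentiable representative of
`volterra (volterra h) + const a + volterra (const b)`. -/
def rep (h : L2C2) (a b : C2) (x : ℝ) : C2 := h.primTwo x + a + x • b

theorem hasDerivAt_rep (h : L2C2) (a b : C2) (x : ℝ) :
    HasDerivAt (rep h a b) (h.prim x + b) x := by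
  have := ((hasDerivAt_id x).smul_const b)
  simpa [rep] using! ((hasDerivAt_primTwo h x).add_const a).add this

theorem contDiff_rep (h : L2C2) (a b : C2) : ContDiff ℝ 1 (rep h a b) := by
  rw [contDiff_one_iff_deriv]
  refine ⟨fun x => (hasDerivAt_rep h a b x).differentiableAt, ?_⟩
  rw [funext fun x => (hasDerivAt_rep h a b x).deriv]
  exact h.continuous_prim.add continuous_const

theorem rep_ae (h : L2C2) (a b : C2) :
    (volterra (volterra h) + const a + volterra (const b) : L2C2) =ᵐ[mu01] rep h a b := by
  filter_upwards [Lp.coeFn_add (volterra (volterra h) + const a) (volterra (const b)),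
    Lp.coeFn_add (volterra (volterra h)) (const a), volterra_ae (volterra h), const_ae a,
    volterra_ae (const b), ae_restrict_mem measurableSet_Ioo] with x h1 h2 h3 h4 h5 hx
  rw [h1, Pi.add_apply, h2, Pi.add_apply, h3, h4, h5, prim_volterra h (Ioo_subset_Icc_self hx),
    prim_const b (Ioo_subset_Icc_self hx), rep]

theorem derivWithin_rep (h : L2C2) (a b : C2) {x : ℝ} (hx : x ∈ Icc (0 : ℝ) 1) :
    derivWithin (rep h a b) (Icc 0 1) x = h.prim x + b :=
  (hasDerivAt_rep h a b x).hasDerivWithinAt.derivWithin (uniqueDiffOn_Icc one_pos x hx)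

/-- Primitives vanish at `0`, so the conditions there fix `a 0` and `b 1`. At `1`, the Dirichlet
condition determines `b 0`, and the Neumann condition is the solvability condition that `h` has mean
zero in the second coordinate; `a 1` stays free. -/
theorem boundaryConditions_rep_iff (h : L2C2) (a b : C2) :
    BoundaryConditions (rep h a b) ↔
      a 0 = 0 ∧ (volterra h).prim 1 0 + b 0 = 0 ∧ b 1 = 0 ∧ h.prim 1 1 = 0 := by
  have h0 : rep h a b 0 = a := by simp [rep, primTwo]
  have h1 : rep h a b 1 = (volterra h).prim 1 + a + b := by
    rw [prim_volterra h (by simp)]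
    simp [rep]
  rw [BoundaryConditions, derivWithin_rep h a b (by simp), derivWithin_rep h a b (by simp),
    h0, h1, prim_zero_right, zero_add, PiLp.add_apply, PiLp.add_apply, PiLp.add_apply]
  constructor
  · rintro ⟨h1, h2, h3, h4⟩
    rw [h1, add_zero] at h2
    rw [h3, add_zero] at h4
    exact ⟨h1, h2, h3, h4⟩
  · rintro ⟨h1, h2, h3, h4⟩
    rw [h1, add_zero, h3, add_zero]
    exact ⟨rfl, h2, rfl, h4⟩

theorem isWeakSecondDeriv_affine (h : L2C2) (a b : C2) :
    IsWeakSecondDeriv (volterra (volterra h) + const a + volterra (const b)) h := by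
  simpa using ((isWeakSecondDeriv_volterra_volterra h).add (isWeakSecondDeriv_const a)).add
    (isWeakSecondDeriv_volterra_const b)

theorem opD_apply_eq {f : opD.domain} {h : L2C2} (hf : IsWeakSecondDeriv (f : L2C2) h) :
    opD f = -h := by
  have : weakSecondDeriv (Submodule.inclusion domD_le_sobolev22 f) = h :=
    (weakSecondDeriv_spec (Submodule.inclusion domD_le_sobolev22 f)).unique hf
  rw [← this]
  rfl

/-- Every element of the domain of `D` is an iterated primitive plus an affine function. -/
theorem exists_eq_of_mem_domain (f : opD.domain) :
    ∃ h a b, (f : L2C2) = volterra (volterra h) + const a + volterra (const b) ∧ opD f = -h ∧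
      BoundaryConditions (rep h a b) := by
  obtain ⟨f, ⟨h, hf⟩, u, hu, hfu, hbc⟩ := f
  have h1 : IsWeakSecondDeriv (f - volterra (volterra h)) 0 := by
    have := hf.add ((isWeakSecondDeriv_volterra_volterra h).smul (-1))
    simpa [sub_eq_add_neg] using this
  obtain ⟨a, b, hab⟩ := exists_eq_const_add_volterra_const h1
  have h2 : f = volterra (volterra h) + const a + volterra (const b) := by
    rw [add_assoc, ← hab, add_sub_cancel]
  refine ⟨h, a, b, h2, opD_apply_eq hf, ?_⟩
  have h3 : u =ᵐ[mu01] rep h a b := hfu.symm.trans (h2 ▸ rep_ae h a b)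
  -- Continuity upgrades almost everywhere equality to equality on the closed interval, so values
  -- and one-sided derivatives at the endpoints agree.
  rw [mu01, restrict_Ioo_eq_restrict_Icc] at h3
  have h4 : EqOn u (rep h a b) (Icc 0 1) := Measure.eqOn_Icc_of_ae_eq volume zero_ne_one h3
    hu.continuousOn (contDiff_rep h a b).continuous.continuousOn
  have m0 : (0 : ℝ) ∈ Icc (0 : ℝ) 1 := by simp
  have m1 : (1 : ℝ) ∈ Icc (0 : ℝ) 1 := by simp
  rw [BoundaryConditions, h4 m0, h4 m1, derivWithin_congr h4 (h4 m0),
    derivWithin_congr h4 (h4 m1)] at hbc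
  exact hbc

/-! ### The inverse of `D + P` -/

/-- The integral of the `i`-th coordinate. -/
def coordInt (i : Fin 2) : L2C2 →L[ℂ] ℂ := (EuclideanSpace.proj i).comp (primL 1)

theorem coordInt_apply (i : Fin 2) (g : L2C2) : coordInt i g = g.prim 1 i := rfl

theorem coordInt_const (i : Fin 2) (c : C2) : coordInt i (const c) = c i := by
  rw [coordInt_apply, prim_const c (by simp), one_smul]

theorem coordInt_volterra_const (i : Fin 2) (c : C2) :
    coordInt i (volterra (const c)) = c i / 2 := by
  have h : ∫ t in (0 : ℝ)..1, (const c).prim t = ∫ t in (0 : ℝ)..1, t • c :=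
    intervalIntegral.integral_congr fun t ht => prim_const c (by simpa using ht)
  rw [coordInt_apply, prim_volterra _ (by simp), primTwo, h,
    intervalIntegral.integral_smul_const, integral_id]
  simp
  ring

theorem coordInt_volterra_volterra_const (i : Fin 2) (c : C2) :
    coordInt i (volterra (volterra (const c))) = c i / 6 := by
  have h1 {x : ℝ} (hx : x ∈ Icc (0 : ℝ) 1) : (volterra (const c)).prim x = (x ^ 2 / 2) • c := by
    have h : ∫ t in (0 : ℝ)..x, (const c).prim t = ∫ t in (0 : ℝ)..x, t • c :=
      intervalIntegral.integral_congr fun t ht => by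
        rw [uIcc_of_le hx.1] at ht
        exact prim_const c ⟨ht.1, ht.2.trans hx.2⟩
    rw [prim_volterra _ hx, primTwo, h, intervalIntegral.integral_smul_const, integral_id]
    simp
  have h : ∫ t in (0 : ℝ)..1, (volterra (const c)).prim t
      = ∫ t in (0 : ℝ)..1, (t ^ 2 / 2) • c :=
    intervalIntegral.integral_congr fun t ht => h1 (by simpa using ht)
  rw [coordInt_apply, prim_volterra _ (by simp), primTwo, h,
    intervalIntegral.integral_smul_const, intervalIntegral.integral_div, integral_pow]
  simp
  ring

/-- The `i`-th standard basis vector as a constant function. -/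
def basisConst (i : Fin 2) : L2C2 := const (EuclideanSpace.single i 1)

@[simp] theorem coordInt_basisConst_self (i : Fin 2) : coordInt i (basisConst i) = 1 := by
  simp [basisConst, coordInt_const]

theorem coordInt_basisConst_ne {i j : Fin 2} (h : i ≠ j) : coordInt i (basisConst j) = 0 := by
  simp [basisConst, coordInt_const, h]

theorem smul_basisConst (i : Fin 2) (z : ℂ) :
    z • basisConst i = const (EuclideanSpace.single i z) := by
  rw [basisConst, ← map_smul]
  congr 1
  ext j
  simp

/-- The projection onto the kernel of `D`. -/
def kerProj : L2C2 →L[ℂ] L2C2 := (coordInt 1).smulRight (basisConst 1)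

theorem kerProj_apply (g : L2C2) : kerProj g = coordInt 1 g • basisConst 1 := rfl

/-- The inverse of `D + kerProj`. -/
def green : L2C2 →L[ℂ] L2C2 :=
  kerProj - (1 - kerProj) ∘L volterra ∘L volterra ∘L (1 - kerProj)
    + (coordInt 0 ∘L volterra ∘L (1 - kerProj)).smulRight (volterra (basisConst 0))

theorem green_apply (g : L2C2) : green g =
    kerProj g - (volterra (volterra (g - kerProj g)) - kerProj (volterra (volterra (g - kerProj g))))
      + coordInt 0 (volterra (g - kerProj g)) • volterra (basisConst 0) := rfl

/-- The factor `1 - kerProj` removes the mean of the second coordinate, and the linear correction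
lives in the first coordinate. Hence `P G = P`, which lets `P f` be recovered from `f = G (...)`. -/
theorem coordInt_one_green (g : L2C2) : coordInt 1 (green g) = coordInt 1 g := by
  have h : coordInt 1 (volterra (basisConst 0)) = 0 := by
    rw [basisConst, coordInt_volterra_const]
    simp
  simp [green_apply, kerProj_apply, h]

theorem green_basisConst_one : green (basisConst 1) = basisConst 1 := by
  simp [green_apply, kerProj_apply]

theorem isCompactOperator_kerProj : IsCompactOperator kerProj := by
  have h : IsCompactOperator (coordInt 1) := isCompactOperator_of_locallyCompactSpace_dom _
  exact h.clm_comp ((1 : ℂ →L[ℂ] ℂ).smulRight (basisConst 1))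

theorem isCompactOperator_green : IsCompactOperator green := by
  have h1 : IsCompactOperator ((1 - kerProj) ∘L volterra ∘L volterra ∘L (1 - kerProj)) :=
    (isCompactOperator_volterra.comp_clm (volterra ∘L (1 - kerProj))).continuous_comp
      (g := (1 - kerProj : L2C2 →L[ℂ] L2C2)) (ContinuousLinearMap.continuous _)
  have h2 : IsCompactOperator
      ((coordInt 0 ∘L volterra ∘L (1 - kerProj)).smulRight (volterra (basisConst 0))) := by
    have h : IsCompactOperator (coordInt 0 ∘L volterra ∘L (1 - kerProj)) :=
      isCompactOperator_of_locallyCompactSpace_dom _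
    exact h.clm_comp ((1 : ℂ →L[ℂ] ℂ).smulRight (volterra (basisConst 0)))
  exact (isCompactOperator_kerProj.sub h1).add h2

/-- This form lets the weak second derivative and the boundary values be read off. -/
theorem green_eq_affine (g : L2C2) : green g =
    volterra (volterra (kerProj g - g))
      + const (EuclideanSpace.single 1
        (coordInt 1 g + coordInt 1 (volterra (volterra (g - kerProj g)))))
      + volterra (const (EuclideanSpace.single 0 (coordInt 0 (volterra (g - kerProj g))))) := by
  rw [green_apply, ← smul_basisConst, ← smul_basisConst, map_smul, kerProj_apply, kerProj_apply,
    ← neg_sub g, map_neg, map_neg, add_smul]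
  abel

theorem boundaryConditions_green (g : L2C2) :
    BoundaryConditions (rep (kerProj g - g)
      (EuclideanSpace.single 1
        (coordInt 1 g + coordInt 1 (volterra (volterra (g - kerProj g)))))
      (EuclideanSpace.single 0 (coordInt 0 (volterra (g - kerProj g))))) := by
  rw [boundaryConditions_rep_iff, ← coordInt_apply, ← coordInt_apply]
  refine ⟨by simp, ?_, by simp, ?_⟩
  · simp
  · simp [kerProj_apply]

theorem green_mem_domain (g : L2C2) : green g ∈ opD.domain :=
  ⟨⟨_, green_eq_affine g ▸ isWeakSecondDeriv_affine _ _ _⟩, _,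
    (contDiff_rep _ _ _).contDiffOn, green_eq_affine g ▸ rep_ae _ _ _,
    boundaryConditions_green g⟩

theorem opD_green (g : L2C2) : opD ⟨green g, green_mem_domain g⟩ = g - kerProj g := by
  rw [← neg_sub]
  refine opD_apply_eq ?_
  dsimp only
  rw [green_eq_affine]
  exact isWeakSecondDeriv_affine _ _ _

theorem green_opD_add (f : opD.domain) : green (opD f + kerProj f) = f := by
  obtain ⟨h, a, b, hf, hD, hbc⟩ := exists_eq_of_mem_domain f
  rw [boundaryConditions_rep_iff, ← coordInt_apply, ← coordInt_apply] at hbc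
  obtain ⟨h1, h2, h3, h4⟩ := hbc
  have ea : a = EuclideanSpace.single 1 (a 1) := by
    ext i
    fin_cases i <;> simp [h1]
  have eb : b = EuclideanSpace.single 0 (b 0) := by
    ext i
    fin_cases i <;> simp [h3]
  have h5 : coordInt 1 (-h + kerProj f) = coordInt 1 (f : L2C2) := by
    simp [kerProj_apply, h4]
  have h6 : kerProj (-h + kerProj f) = kerProj f := by
    rw [kerProj_apply, h5, ← kerProj_apply]
  -- The free constant `a 1` is determined by the mean of the second coordinate; the Dirichlet
  -- condition `h2` determines `b 0`.
  have h7 : coordInt 1 (f : L2C2) = coordInt 1 (volterra (volterra h)) + a 1 := by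
    rw [hf, map_add, map_add, coordInt_const, coordInt_volterra_const, h3]
    ring
  rw [hD, green_eq_affine, h6, h5, sub_add_cancel_right, neg_neg, add_sub_cancel_right, h7]
  conv_rhs => rw [hf, ea, eb]
  congr 3
  · congr 1
    simp
  · congr 1
    rw [map_neg, map_neg]
    linear_combination -h2

end L2C2

/-- A rank-one perturbation `f = c • e + z • S f` with `L f = 0` and `L e ≠ 0` has only the
trivial solution for small `z`. -/
theorem exists_forall_eq_zero_of_eq_smul_add_smul {X : Type*} [NormedAddCommGroup X]
    [NormedSpace ℂ X] (S : X →L[ℂ] X) (L : X →L[ℂ] ℂ) {e : X} (he : L e ≠ 0) :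
    ∃ δ > 0, ∀ z : ℂ, ‖z‖ < δ → ∀ (f : X) (c : ℂ), f = c • e + z • S f → L f = 0 → f = 0 := by
  have he' : 0 < ‖L e‖ := norm_pos_iff.2 he
  -- Solving `L f = 0` for `c` and inserting it into the norm of `f` yields `‖L e‖ * ‖f‖ ≤ ‖z‖ * C *
  -- ‖f‖`; the `+ 1` keeps `C` positive.
  set C : ℝ := ‖L‖ * ‖S‖ * ‖e‖ + ‖L e‖ * ‖S‖ + 1 with hC
  have hC0 : 0 < C := by positivity
  refine ⟨‖L e‖ / C, by positivity, fun z hz f c hf hLf => ?_⟩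
  rw [lt_div_iff₀ hC0] at hz
  have h1 : c * L e = -(z * L (S f)) := by
    have h0 : L f = c * L e + z * L (S f) := by
      conv_lhs => rw [hf, map_add, map_smul, map_smul, smul_eq_mul, smul_eq_mul]
    linear_combination hLf - h0
  have h2 : ‖c‖ * ‖L e‖ ≤ ‖z‖ * (‖L‖ * (‖S‖ * ‖f‖)) := by
    rw [← norm_mul, h1, norm_neg, norm_mul]
    gcongr
    exact (L.le_opNorm _).trans (by gcongr; exact S.le_opNorm f)
  have h3 : ‖f‖ ≤ ‖c‖ * ‖e‖ + ‖z‖ * (‖S‖ * ‖f‖) := by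
    conv_lhs => rw [hf]
    refine (norm_add_le _ _).trans ?_
    rw [norm_smul, norm_smul]
    gcongr
    exact S.le_opNorm f
  have h4 : ‖L e‖ * ‖f‖ ≤ ‖z‖ * C * ‖f‖ := by
    have h5 := mul_le_mul_of_nonneg_left h3 he'.le
    have h6 := mul_le_mul_of_nonneg_right h2 (norm_nonneg e)
    have h7 : 0 ≤ ‖z‖ * ‖f‖ := by positivity
    rw [hC]
    linarith
  by_contra hne
  exact absurd (le_of_mul_le_mul_right h4 (norm_pos_iff.2 hne)) (not_le.2 hz)

namespace L2C2

/-! ### Multiplication by a matrix -/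

theorem mulA_mul (A B : Matrix (Fin 2) (Fin 2) ℂ) (f : L2C2) :
    mulA A (mulA B f) = mulA (A * B) f := by
  apply Lp.ext
  filter_upwards [ContinuousLinearMap.coeFn_compLpL
      (Matrix.toEuclideanCLM (n := Fin 2) (𝕜 := ℂ) A) (mulA B f),
    ContinuousLinearMap.coeFn_compLpL (Matrix.toEuclideanCLM (n := Fin 2) (𝕜 := ℂ) B) f,
    ContinuousLinearMap.coeFn_compLpL
      (Matrix.toEuclideanCLM (n := Fin 2) (𝕜 := ℂ) (A * B)) f] with x h1 h2 h3
  refine h1.trans (Eq.trans ?_ h3.symm)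
  rw [map_mul, mul_apply_eq_comp]
  exact congrArg _ h2

theorem mulA_one (f : L2C2) : mulA 1 f = f := by
  apply Lp.ext
  filter_upwards [ContinuousLinearMap.coeFn_compLpL
      (Matrix.toEuclideanCLM (n := Fin 2) (𝕜 := ℂ) 1) f] with x h1
  refine h1.trans ?_
  rw [map_one, one_apply_eq_self]

theorem prim_mulA (A : Matrix (Fin 2) (Fin 2) ℂ) (f : L2C2) (x : ℝ) :
    (mulA A f).prim x = Matrix.toEuclideanCLM (n := Fin 2) (𝕜 := ℂ) A (f.prim x) := by
  rw [prim, prim, ← ContinuousLinearMap.integral_comp_comm _ f.integrable.integrableOn]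
  exact integral_congr_ae (ae_restrict_of_ae (ContinuousLinearMap.coeFn_compLpL _ f))

theorem coordInt_mulA (A : Matrix (Fin 2) (Fin 2) ℂ) (i : Fin 2) (f : L2C2) :
    coordInt i (mulA A f) = A i 0 * coordInt 0 f + A i 1 * coordInt 1 f := by
  rw [coordInt_apply, prim_mulA]
  rw [Matrix.ofLp_toEuclideanCLM]
  simp [Matrix.mulVec, dotProduct, coordInt_apply]

theorem mulA_const (A : Matrix (Fin 2) (Fin 2) ℂ) (c : C2) :
    mulA A (const c) = const (Matrix.toEuclideanCLM (n := Fin 2) (𝕜 := ℂ) A c) := by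
  apply Lp.ext
  filter_upwards [ContinuousLinearMap.coeFn_compLpL
      (Matrix.toEuclideanCLM (n := Fin 2) (𝕜 := ℂ) A) (const c), const_ae c,
    const_ae (Matrix.toEuclideanCLM (n := Fin 2) (𝕜 := ℂ) A c)] with x h1 h2 h3
  rw [h3]
  refine h1.trans ?_
  rw [h2]

theorem mulA_basisConst_one (A : Matrix (Fin 2) (Fin 2) ℂ) :
    mulA A (basisConst 1) = A 0 1 • basisConst 0 + A 1 1 • basisConst 1 := by
  rw [smul_basisConst, smul_basisConst, basisConst, mulA_const, ← map_add]
  congr 1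
  ext i
  rw [Matrix.ofLp_toEuclideanCLM]
  fin_cases i <;> simp [Matrix.mulVec, dotProduct]

/-! ### The resolvent of `AD` -/

variable {A : Matrix (Fin 2) (Fin 2) ℂ}

theorem opAD_apply (A : Matrix (Fin 2) (Fin 2) ℂ) (f : opD.domain) :
    opAD A f = mulA A (opD f) := rfl

theorem mulA_inv_mulA (hA : A.det ≠ 0) (f : L2C2) : mulA A⁻¹ (mulA A f) = f := by
  rw [mulA_mul, Matrix.nonsing_inv_mul _ (isUnit_iff_ne_zero.2 hA), mulA_one]

theorem mulA_mulA_inv (hA : A.det ≠ 0) (f : L2C2) : mulA A (mulA A⁻¹ f) = f := by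
  rw [mulA_mul, Matrix.mul_nonsing_inv _ (isUnit_iff_ne_zero.2 hA), mulA_one]

/-- The compact operator `K` for which `(AD - z) f = g` reads `f - K f = green (A⁻¹ g)`. -/
def pencil (A : Matrix (Fin 2) (Fin 2) ℂ) (z : ℂ) : L2C2 →L[ℂ] L2C2 :=
  green ∘L (kerProj + z • mulA A⁻¹)

theorem pencil_apply (A : Matrix (Fin 2) (Fin 2) ℂ) (z : ℂ) (f : L2C2) :
    pencil A z f = green (kerProj f + z • mulA A⁻¹ f) := rfl

theorem isCompactOperator_pencil (A : Matrix (Fin 2) (Fin 2) ℂ) (z : ℂ) :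
    IsCompactOperator (pencil A z) :=
  isCompactOperator_green.comp_clm (kerProj + z • mulA A⁻¹)

theorem sub_pencil_eq (hA : A.det ≠ 0) (z : ℂ) (f : opD.domain) :
    (f : L2C2) - pencil A z f = green (mulA A⁻¹ (opAD A f - z • (f : L2C2))) := by
  rw [opAD_apply, map_sub, mulA_inv_mulA hA, map_smul, pencil_apply]
  nth_rw 1 [← green_opD_add f]
  rw [← map_sub]
  congr 1
  abel

/-- The converse of `sub_pencil_eq`: the equation exhibits `f` as a value of `green`, which supplies
membership in the domain. -/
theorem opAD_sub_smul_eq (hA : A.det ≠ 0) {z : ℂ} {f g : L2C2}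
    (h : f - pencil A z f = green (mulA A⁻¹ g)) :
    ∃ hf : f ∈ (opAD A).domain, opAD A ⟨f, hf⟩ - z • f = g := by
  have hf : f = green (kerProj f + z • mulA A⁻¹ f + mulA A⁻¹ g) := by
    rw [map_add, ← h, ← pencil_apply, add_sub_cancel]
  have hd : f ∈ opD.domain := hf ▸ green_mem_domain _
  refine ⟨hd, ?_⟩
  have hk : kerProj (kerProj f + z • mulA A⁻¹ f + mulA A⁻¹ g) = kerProj f := by
    rw [kerProj_apply, ← coordInt_one_green, ← hf, ← kerProj_apply]
  have hD : opD ⟨f, hd⟩ = z • mulA A⁻¹ f + mulA A⁻¹ g := by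
    have e : (⟨f, hd⟩ : opD.domain) = ⟨_, green_mem_domain _⟩ := Subtype.ext hf
    rw [e, opD_green, hk]
    abel
  change mulA A (opD ⟨f, hd⟩) - z • f = g
  rw [hD, map_add, map_smul, mulA_mulA_inv hA, mulA_mulA_inv hA,
    add_sub_cancel_left]

/-- The Fredholm alternative for the compact operator `pencil A z` at the value `1`. -/
theorem exists_isResolventAt_of_injective (hA : A.det ≠ 0) {z : ℂ}
    (h : ∀ f, pencil A z f = f → f = 0) : ∃ R, IsResolventAt (opAD A) z R := by
  rcases IsCompactOperator.hasEigenvalue_or_mem_resolventSet (isCompactOperator_pencil A z)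
    (one_ne_zero (α := ℂ)) with h1 | h1
  · obtain ⟨f, hf⟩ := h1.exists_hasEigenvector
    have := hf.apply_eq_smul
    rw [one_smul] at this
    exact absurd (h f this) hf.2
  · rw [spectrum.mem_resolventSet_iff, map_one] at h1
    obtain ⟨U, hU⟩ := h1
    have hl (f : L2C2) : (U⁻¹).1 (f - pencil A z f) = f := by
      have := congrArg (fun T : L2C2 →L[ℂ] L2C2 => T f) U.inv_mul
      rwa [hU] at this
    have hr (f : L2C2) : (U⁻¹).1 f - pencil A z ((U⁻¹).1 f) = f := by
      have := congrArg (fun T : L2C2 →L[ℂ] L2C2 => T f) U.mul_inv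
      rwa [hU] at this
    refine ⟨(U⁻¹).1 ∘L green ∘L mulA A⁻¹, fun g => opAD_sub_smul_eq hA (hr _), fun f => ?_⟩
    have := sub_pencil_eq hA z f
    rw [ContinuousLinearMap.comp_apply, ContinuousLinearMap.comp_apply, ← this, hl]

/-- Here `M` sends `basisConst 1` to a multiple of `basisConst 0`, and `1 / 12` is the mean of `x (1
- x) / 2`, the Dirichlet solution of `-u'' = 1`. -/
theorem coordInt_mulA_green_mulA {M : Matrix (Fin 2) (Fin 2) ℂ} (h : M 1 1 = 0) :
    coordInt 1 (mulA M (green (mulA M (basisConst 1)))) = M 1 0 * M 0 1 / 12 := by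
  have h0 : kerProj (basisConst 0) = 0 := by
    rw [kerProj_apply, coordInt_basisConst_ne (by decide), zero_smul]
  have h1 : coordInt 0 (green (basisConst 0)) = 1 / 12 := by
    rw [green_apply, h0, sub_zero]
    simp only [kerProj_apply, map_add, map_sub, map_smul, smul_eq_mul, map_zero,
      coordInt_basisConst_ne (show (0 : Fin 2) ≠ 1 by decide)]
    simp only [basisConst, coordInt_volterra_const, coordInt_volterra_volterra_const]
    norm_num
  rw [mulA_basisConst_one, h, zero_smul, add_zero, map_smul, map_smul, map_smul, smul_eq_mul,
    coordInt_mulA, h, h1]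
  ring

theorem exists_pencil_injective (hA : A.det ≠ 0) :
    ∃ z, ∀ f, pencil A z f = f → f = 0 := by
  set M := A⁻¹ with hM
  have key {z : ℂ} (hz : z ≠ 0) {f : L2C2} (hf : pencil A z f = f) :
      coordInt 1 (mulA M f) = 0 ∧
        f = coordInt 1 f • basisConst 1 + z • (green ∘L mulA M) f := by
    constructor
    -- As `green` preserves the mean of the second coordinate, the `kerProj` term cancels and `z`
    -- can be divided out.
    · have := congrArg (coordInt 1) hf
      rw [pencil_apply, coordInt_one_green] at this
      simpa [kerProj_apply, hz] using this
    · conv_lhs => rw [← hf, pencil_apply, map_add, kerProj_apply, map_smul, map_smul,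
        green_basisConst_one]
      rfl
  obtain ⟨L, hLe, hL⟩ : ∃ L : L2C2 →L[ℂ] ℂ, L (basisConst 1) ≠ 0 ∧
      ∀ z : ℂ, z ≠ 0 → ∀ f, pencil A z f = f → L f = 0 := by
    by_cases h : M 1 1 = 0
    · refine ⟨coordInt 1 ∘L mulA M ∘L green ∘L mulA M, ?_, fun z hz f hf => ?_⟩
      · have hdet : M.det ≠ 0 := by
          rw [hM, Matrix.det_nonsing_inv, Ring.inverse_eq_inv']
          exact inv_ne_zero hA
        rw [Matrix.det_fin_two, h, mul_zero, zero_sub, neg_ne_zero] at hdet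
        refine (coordInt_mulA_green_mulA h).trans_ne ?_
        rw [mul_comm (M 1 0)]
        exact div_ne_zero hdet (by norm_num)
      · obtain ⟨h1, h2⟩ := key hz hf
        -- Inserting `f = c e + z G M f` into the mean condition kills the first term because `M 1 1
        -- = 0`, leaving `z * L f = 0`.
        rw [h2, map_add, map_smul, map_add, map_smul, map_smul, coordInt_mulA M 1 (basisConst 1),
          h, coordInt_basisConst_ne (by decide)] at h1
        simpa [hz] using h1
    · refine ⟨coordInt 1 ∘L mulA M, ?_, fun z hz f hf => (key hz hf).1⟩
      refine Eq.trans_ne (b := M 1 1) ?_ h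
      rw [ContinuousLinearMap.comp_apply, coordInt_mulA,
        coordInt_basisConst_ne (by decide), coordInt_basisConst_self]
      ring
  obtain ⟨δ, hδ, H⟩ := exists_forall_eq_zero_of_eq_smul_add_smul (green ∘L mulA M) L hLe
  have hz : ((δ / 2 : ℝ) : ℂ) ≠ 0 := by
    exact_mod_cast (half_pos hδ).ne'
  refine ⟨(δ / 2 : ℝ), fun f hf => H _ ?_ f _ (key hz hf).2 (hL _ hz f hf)⟩
  rw [Complex.norm_real, Real.norm_of_nonneg (half_pos hδ).le]
  exact half_lt_self hδ

theorem isCompactOperator_of_isResolventAt (hA : A.det ≠ 0) {z : ℂ} {R : L2C2 →L[ℂ] L2C2}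
    (hR : IsResolventAt (opAD A) z R) : IsCompactOperator R := by
  have h : R = pencil A z ∘L R + green ∘L mulA A⁻¹ := by
    ext1 g
    obtain ⟨hg, h⟩ := hR.1 g
    have : R g - pencil A z (R g) = green (mulA A⁻¹ (opAD A ⟨R g, hg⟩ - z • R g)) :=
      sub_pencil_eq hA z ⟨R g, hg⟩
    rw [h, sub_eq_iff_eq_add'] at this
    exact this
  rw [h]
  exact ((isCompactOperator_pencil A z).comp_clm R).add (isCompactOperator_green.comp_clm _)

end L2C2

end

theorem mainTheorem5 (A : Matrix (Fin 2) (Fin 2) ℂ) (hA : A.det ≠ 0) :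
    unboundedSpectrum (opAD A) ≠ Set.univ ∧
      ∀ (z : ℂ) (hz : z ∉ unboundedSpectrum (opAD A)),
        IsCompactOperator (unboundedResolvent (opAD A) z hz) := by
  refine ⟨fun h => ?_, fun z hz =>
    L2C2.isCompactOperator_of_isResolventAt hA (unboundedResolvent_spec _ z hz)⟩
  obtain ⟨z, hz⟩ := L2C2.exists_pencil_injective hA
  have : z ∈ unboundedSpectrum (opAD A) := h ▸ mem_univ z
  exact this (L2C2.exists_isResolventAt_of_injective hA hz)
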